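/- Let $N\ge 1$ and let $f:\mathbb{R}^N\to\mathbb{R}^N$ be a Borel map that is self-continuous on $\mathbb{R}^N$, that is, at every point $x\in\mathbb{R}^N$ at least one of the following two conditions holds: (ray sense) $\displaystyle\lim_{\varepsilon\to0^+} f\bigl(x+\varepsilon f(x)\bigr)=f(x)$; (curve sense) there are $\varepsilon_0>0$ and a $\mathcal C^1$ curve $\phi:[0,\varepsilon_0)\to\mathbb{R}^N$ with $\phi(0)=x$, $\phi'(0)=f(x)$ and $\displaystyle\lim_{\varepsilon\to0^+}\bigl[\phi'(\varepsilon)-f(\phi(\varepsilon))\bigr]=0$. Suppose also that there are real constants $C_1, C_0$ with $|f(z)|\le C_1|z|+C_0$ for every $z\in\mathbb{R}^N$. Then for every $x_0\in\mathbb{R}^N$ and every $T>0$ the Cauchy problem $$x'(t)=f(x(t))\ \text{ in }(0,T),\qquad x(0)=x_0,$$ has at least one generalized solution, that is, there is an absolutely continuous path $x:[0,T]\to\mathbb{R}^N$ with $x(0)=x_0$ for which there exist absolutely continuous paths $x_j:[0,T]\to\mathbb{R}^N$, $j\in\mathbb{N}$, with $x_j(0)=x_0$, such that, as $j\to\infty$,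 $$x_j\rightharpoonup x\ \text{ weakly in } W^{1,1}(0,T;\mathbb{R}^N)\qquad\text{and}\qquad \int_0^T|x_j'(t)-f(x_j(t))|\,dt\to0 .$$ -/

import Mathlib

open MeasureTheory Filter Set Topology
open scoped ENNReal

noncomputable section

namespace SelfCont

/-- `ℝ^N` with its Euclidean norm. -/
abbrev E (N : ℕ) : Type := EuclideanSpace ℝ (Fin N)

/-! ### Self-continuity -/

/-- Self-continuity at `x` along the ray: `f (x + ε f x) → f x` as `ε → 0⁺`. -/
def RaySelfContinuousAt {N : ℕ} (f : E N → E N) (x : E N) : Prop :=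
  Tendsto (fun ε : ℝ => f (x + ε • f x)) (𝓝[>] 0) (𝓝 (f x))

/-- Self-continuity at `x` along a curve: there is a `C¹` curve `φ` on some `[0, ε₀)`, `ε₀ > 0`,
with `φ 0 = x`, `φ' 0 = f x` (one-sided derivative at the end point `0`) and
`φ' ε - f (φ ε) → 0` as `ε → 0⁺`. -/
def CurveSelfContinuousAt {N : ℕ} (f : E N → E N) (x : E N) : Prop :=
  ∃ (ε₀ : ℝ) (φ : ℝ → E N), 0 < ε₀ ∧ ContDiffOn ℝ 1 φ (Ico 0 ε₀) ∧ φ 0 = x ∧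
    derivWithin φ (Ico 0 ε₀) 0 = f x ∧
    Tendsto (fun ε : ℝ => derivWithin φ (Ico 0 ε₀) ε - f (φ ε)) (𝓝[>] 0) (𝓝 0)

/-- Self-continuity on all of `ℝ^N`: at every point, in the ray sense or in the curve sense. -/
def SelfContinuous {N : ℕ} (f : E N → E N) : Prop :=
  ∀ x : E N, RaySelfContinuousAt f x ∨ CurveSelfContinuousAt f x

/-! ### Absolutely continuous paths and the Sobolev space `W^{1,1}(0, T; ℝ^N)` -/

theorem coord_absolutelyContinuous {N : ℕ} {T : ℝ} {x : ℝ → E N}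
    (hx : AbsolutelyContinuousOnInterval x 0 T) (i : Fin N) :
    AbsolutelyContinuousOnInterval (fun t => x t i) 0 T := by
  refine squeeze_zero (fun _ => Finset.sum_nonneg fun _ _ => dist_nonneg) (fun I => ?_) hx
  refine Finset.sum_le_sum fun k _ => ?_
  rw [Real.dist_eq, dist_eq_norm, ← Real.norm_eq_abs]
  exact PiLp.norm_apply_le (x (I.2 k).1 - x (I.2 k).2) i

theorem ae_differentiableAt_path {N : ℕ} {T : ℝ} {x : ℝ → E N}
    (hx : AbsolutelyContinuousOnInterval x 0 T) :
    ∀ᵐ t ∂(volume.restrict (Ioo 0 T)), DifferentiableAt ℝ x t := by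
  refine (ae_restrict_iff' measurableSet_Ioo).2 ?_
  filter_upwards [hx.boundedVariationOn.ae_differentiableAt_of_mem_uIcc] with t ht hmem
  exact ht (Icc_subset_uIcc (Ioo_subset_Icc_self hmem))

theorem memLp_path {N : ℕ} {T : ℝ} {x : ℝ → E N}
    (hx : AbsolutelyContinuousOnInterval x 0 T) :
    MemLp x 1 (volume.restrict (Ioo 0 T)) := by
  refine memLp_one_iff_integrable.2 ?_
  have h : IntegrableOn x (uIcc 0 T) := hx.continuousOn.integrableOn_compact isCompact_uIcc
  exact h.mono_set (Ioo_subset_Icc_self.trans Icc_subset_uIcc)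

theorem memLp_deriv_path {N : ℕ} {T : ℝ} {x : ℝ → E N}
    (hx : AbsolutelyContinuousOnInterval x 0 T) :
    MemLp (deriv x) 1 (volume.restrict (Ioo 0 T)) := by
  refine memLp_one_iff_integrable.2 (Integrable.of_eval_piLp fun i => ?_)
  have h1 : IntegrableOn (deriv fun t => x t i) (Ioo 0 T) volume := by
    have := (intervalIntegrable_iff.1 (coord_absolutelyContinuous hx i).intervalIntegrable_deriv)
    exact this.mono_set (Ioo_subset_Ioc_self.trans Ioc_subset_uIoc)
  refine Integrable.congr h1 ?_
  filter_upwards [ae_differentiableAt_path hx] with t ht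
  exact (((EuclideanSpace.proj i : E N →L[ℝ] ℝ).hasFDerivAt.comp_hasDerivAt t
    ht.hasDerivAt)).deriv

/-- The space `L¹(0, T; ℝ^N)`. -/
abbrev L1 (N : ℕ) (T : ℝ) : Type := Lp (E N) 1 (volume.restrict (Ioo (0 : ℝ) T))

/-- The Sobolev space `W^{1,1}(0, T; ℝ^N)` of absolutely continuous paths on `[0, T]`. A path `x`
is recorded as the pair `(x, x')` of classes in `L¹ × L¹`; the norm inherited from `L¹ × L¹` is
`max ‖x‖₁ ‖x'‖₁`, which is equivalent to `‖x‖₁ + ‖x'‖₁`. -/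
def W11 (N : ℕ) (T : ℝ) : Submodule ℝ (L1 N T × L1 N T) where
  carrier := {p | ∃ x : ℝ → E N, AbsolutelyContinuousOnInterval x 0 T ∧
    p.1 =ᵐ[volume.restrict (Ioo 0 T)] x ∧ p.2 =ᵐ[volume.restrict (Ioo 0 T)] deriv x}
  zero_mem' := by
    refine ⟨fun _ => 0, ?_, Lp.coeFn_zero _ _ _, ?_⟩
    · exact (LipschitzOnWith.of_dist_le_mul (K := 0)
        fun _ _ _ _ => by simp).absolutelyContinuousOnInterval
    · filter_upwards [Lp.coeFn_zero (E N) 1 (volume.restrict (Ioo (0 : ℝ) T))] with t ht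
      simpa using ht
  add_mem' := by
    rintro p q ⟨x, hx, hp1, hp2⟩ ⟨y, hy, hq1, hq2⟩
    refine ⟨x + y, hx.add hy, ?_, ?_⟩
    · exact (Lp.coeFn_add p.1 q.1).trans (hp1.add hq1)
    · refine (Lp.coeFn_add p.2 q.2).trans ((hp2.add hq2).trans ?_)
      filter_upwards [ae_differentiableAt_path hx, ae_differentiableAt_path hy] with t h1 h2
      exact (deriv_add h1 h2).symm
  smul_mem' := by
    rintro c p ⟨x, hx, hp1, hp2⟩
    refine ⟨fun t => c • x t, hx.const_smul c, ?_, ?_⟩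
    · exact (Lp.coeFn_smul c p.1).trans (hp1.const_smul c)
    · refine (Lp.coeFn_smul c p.2).trans ((hp2.const_smul c).trans ?_)
      filter_upwards [ae_differentiableAt_path hx] with t h1
      exact (deriv_fun_const_smul c h1).symm

/-- The element of `W^{1,1}(0, T; ℝ^N)` given by an absolutely continuous path on `[0, T]`. -/
def toW11 {N : ℕ} {T : ℝ} (x : ℝ → E N) (hx : AbsolutelyContinuousOnInterval x 0 T) : W11 N T :=
  ⟨((memLp_path hx).toLp x, (memLp_deriv_path hx).toLp (deriv x)),
    x, hx, (memLp_path hx).coeFn_toLp, (memLp_deriv_path hx).coeFn_toLp⟩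

/-! ### Generalized solutions -/

/-- The error `∫_0^T |y'(t) - f (y t)| dt`, as an element of `[0, ∞]`. -/
def pathError {N : ℕ} (f : E N → E N) (T : ℝ) (y : ℝ → E N) : ℝ≥0∞ :=
  ∫⁻ t in Ioo 0 T, ‖deriv y t - f (y t)‖ₑ

/-- `x` is a generalized solution on `[0, T]` of `x' = f x`, `x 0 = x₀`: an absolutely continuous
path starting at `x₀` that is the weak limit in `W^{1,1}(0, T; ℝ^N)` (weak topology of the normed
space) of absolutely continuous paths `y j` starting at `x₀` whose errors tend to `0`. -/
def IsGeneralizedSolution {N : ℕ} (f : E N → E N) (T : ℝ) (x₀ : E N) (x : ℝ → E N) : Prop :=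
  ∃ hx : AbsolutelyContinuousOnInterval x 0 T, x 0 = x₀ ∧
    ∃ (y : ℕ → ℝ → E N) (hy : ∀ j, AbsolutelyContinuousOnInterval (y j) 0 T),
      (∀ j, y j 0 = x₀) ∧
      Tendsto (fun j => toWeakSpace ℝ (W11 N T) (toW11 (y j) (hy j))) atTop
        (𝓝 (toWeakSpace ℝ (W11 N T) (toW11 x hx))) ∧
      Tendsto (fun j => pathError f T (y j)) atTop (𝓝 0)

end SelfCont

end

/-!
Self-continuity supplies, from every point `x` and for every tolerance `η > 0`, a short curve `φ`
issuing from `x` with `|φ' - f φ| ≤ η`: in the ray sense the segment `x + ε f x`, in the curve sense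
the given curve. Short curves are concatenated into an approximate solution on all of `[0, T]`. The
bookkeeping is light because the condition is imposed on the right derivative at *every* time
(`IsApproxSol`): it is then local to the right and passes to unions of chains, so that Zorn's lemma
applies. Linear growth and Grönwall's inequality confine approximate solutions to a fixed ball and
make them Lipschitz with a constant independent of `η ≤ 1`
(`exists_lipschitzOnWith_of_isApproxSol`); hence one that lives on `[0, s)`, `s < T`, has a limit at
`s`, from which it can be continued (`exists_lipschitzWith_isApproxSol`).

Letting `η → 0` yields uniformly Lipschitz paths `y j` whose errors tend to `0`. Their derivatives
are bounded in the separable Hilbert space `L²(0, T; ℝ^N)`, so a subsequence converges weakly there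
to some `v`; testing against indicators of `(0, t)` shows that the paths converge pointwise, and by
domination in `L¹`, to `x t = x₀ + ∫₀ᵗ v` (`exists_subseq_tendsto_W11`). A functional on `W^{1,1}`
extends to `L¹ × L¹` by Hahn–Banach, and on the derivative component it restricts to a functional
on `L²`, so this is weak convergence in `W^{1,1}` (`tendsto_toWeakSpace_toW11`). No continuity of
`f` along the limit is available, nor needed: the limit is only a generalized solution.
-/

namespace SelfCont

/-! ### Self-continuity gives local approximate solutions -/

/-- `y` solves `y' = f y` up to the error `η` on `[0, s)`: it is continuous there and at *every*
point has a right derivative within `η` of `f y`. Using right derivatives makes the condition at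
`t` depend only on the values of `y` just after `t`, so that pieces can be concatenated, even
infinitely many, without exceptional sets. -/
structure IsApproxSol {N : ℕ} (f : E N → E N) (η : ℝ) (s : ℝ) (y : ℝ → E N) : Prop where
  continuousOn : ContinuousOn y (Ico 0 s)
  rightDeriv : ∀ t ∈ Ico 0 s, ∃ d, HasDerivWithinAt y d (Ici t) t ∧ ‖d - f (y t)‖ ≤ η

/-- The ray sense is the curve sense along `ε ↦ x + ε • f x`. -/
theorem RaySelfContinuousAt.curveSelfContinuousAt {N : ℕ} {f : E N → E N} {x : E N}
    (h : RaySelfContinuousAt f x) : CurveSelfContinuousAt f x := by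
  have hd : ∀ t ∈ Ico (0 : ℝ) 1,
      derivWithin (fun ε : ℝ => x + ε • f x) (Ico 0 1) t = f x := fun t ht => by
    have h1 : HasDerivAt (fun ε : ℝ => x + ε • f x) (f x) t := by
      simpa using ((hasDerivAt_id t).smul_const (f x)).const_add x
    exact h1.hasDerivWithinAt.derivWithin ((uniqueDiffOn_Ico 0 1) t ht)
  refine ⟨1, fun ε => x + ε • f x, one_pos, by fun_prop, by simp, hd 0 (by simp), ?_⟩
  have h2 : Tendsto (fun ε : ℝ => f x - f (x + ε • f x)) (𝓝[>] 0) (𝓝 0) := by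
    simpa using h.const_sub (f x)
  refine h2.congr' ?_
  filter_upwards [Ioo_mem_nhdsGT one_pos] with ε hε
  rw [hd ε ⟨hε.1.le, hε.2⟩]

theorem CurveSelfContinuousAt.exists_isApproxSol {N : ℕ} {f : E N → E N} {x : E N}
    (h : CurveSelfContinuousAt f x) {η : ℝ} (hη : 0 < η) :
    ∃ δ > 0, ∃ φ : ℝ → E N, φ 0 = x ∧ IsApproxSol f η δ φ := by
  obtain ⟨ε₀, φ, hε₀, hφ, hφ0, hφ0', hlim⟩ := h
  have hsmall : ∀ᶠ ε in 𝓝[>] (0 : ℝ), ‖derivWithin φ (Ico 0 ε₀) ε - f (φ ε)‖ ≤ η := by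
    filter_upwards [hlim (Metric.closedBall_mem_nhds 0 hη)] with ε hε
    simpa using hε
  obtain ⟨δ, hδ, hsub⟩ := (mem_nhdsGT_iff_exists_Ioo_subset).1 hsmall
  refine ⟨min δ ε₀, lt_min hδ hε₀, φ, hφ0, hφ.continuousOn.mono ?_, fun t ht => ?_⟩
  · exact Ico_subset_Ico_right (min_le_right _ _)
  have htε : t ∈ Ico 0 ε₀ := ⟨ht.1, ht.2.trans_le (min_le_right _ _)⟩
  refine ⟨derivWithin φ (Ico 0 ε₀) t, ?_, ?_⟩
  · have h1 := ((hφ.differentiableOn one_ne_zero) t htε).hasDerivWithinAt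
    have h2 : HasDerivWithinAt φ (derivWithin φ (Ico 0 ε₀) t) (Ico t ε₀) t :=
      h1.mono (Ico_subset_Ico_left ht.1)
    exact h2.mono_of_mem_nhdsWithin (Ico_mem_nhdsGE htε.2)
  · rcases ht.1.eq_or_lt with rfl | h0
    · simp [hφ0', hφ0, hη.le]
    · exact hsub ⟨h0, ht.2.trans_le (min_le_left _ _)⟩

theorem SelfContinuous.exists_isApproxSol {N : ℕ} {f : E N → E N} (hsc : SelfContinuous f)
    (x : E N) {η : ℝ} (hη : 0 < η) :
    ∃ δ > 0, ∃ φ : ℝ → E N, φ 0 = x ∧ IsApproxSol f η δ φ :=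
  ((hsc x).elim (fun h => h.curveSelfContinuousAt) id).exists_isApproxSol hη

/-! ### Continuation of approximate solutions -/

theorem IsApproxSol.congr {N : ℕ} {f : E N → E N} {η s : ℝ} {y z : ℝ → E N}
    (h : IsApproxSol f η s y) (hz : EqOn z y (Ico 0 s)) : IsApproxSol f η s z := by
  refine ⟨h.continuousOn.congr hz, fun t ht => ?_⟩
  obtain ⟨d, hd, hle⟩ := h.rightDeriv t ht
  refine ⟨d, hd.congr_of_eventuallyEq ?_ (hz ht), by rwa [hz ht]⟩
  filter_upwards [Ico_mem_nhdsGE ht.2] with u hu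
  exact hz ⟨ht.1.trans hu.1, hu.2⟩

theorem IsApproxSol.mono {N : ℕ} {f : E N → E N} {η s s' : ℝ} {y : ℝ → E N}
    (h : IsApproxSol f η s y) (hs : s' ≤ s) : IsApproxSol f η s' y :=
  ⟨h.continuousOn.mono (Ico_subset_Ico_right hs),
    fun t ht => h.rightDeriv t ⟨ht.1, ht.2.trans_le hs⟩⟩

/-- A function that agrees with an approximate solution up to every time before `s` is one on
`[0, s)`. -/
theorem isApproxSol_of_forall_lt {N : ℕ} {f : E N → E N} {η s : ℝ} {y : ℝ → E N}
    (h : ∀ t ∈ Ico 0 s, ∃ s' > t, IsApproxSol f η s' y) : IsApproxSol f η s y := by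
  refine ⟨fun t ht => ?_, fun t ht => ?_⟩
  · obtain ⟨s', hs', h'⟩ := h t ht
    refine (h'.continuousOn t ⟨ht.1, hs'⟩).mono_of_mem_nhdsWithin ?_
    filter_upwards [self_mem_nhdsWithin, mem_nhdsWithin_of_mem_nhds (Iio_mem_nhds hs')] with u h1 h2
    exact ⟨h1.1, h2⟩
  · obtain ⟨s', hs', h'⟩ := h t ht
    exact h'.rightDeriv t ⟨ht.1, hs'⟩

/-- Concatenation: `y` up to time `s`, then an approximate solution started at `y s`. -/
theorem IsApproxSol.concat {N : ℕ} {f : E N → E N} {η s δ : ℝ} {y φ : ℝ → E N}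
    (hs : 0 ≤ s) (h : IsApproxSol f η s y) (hy : ContinuousWithinAt y (Iio s) s)
    (hφ : IsApproxSol f η δ φ) (h0 : φ 0 = y s) :
    IsApproxSol f η (s + δ) (fun t => if t < s then y t else φ (t - s)) := by
  set z : ℝ → E N := fun t => if t < s then y t else φ (t - s) with hz
  have hzl : ∀ t < s, z t = y t := fun t ht => by simp [hz, ht]
  have hzr : ∀ t, s ≤ t → z t = φ (t - s) := fun t ht => by simp [hz, ht.not_gt]
  have hzs : z s = y s := by rw [hzr s le_rfl, sub_self, h0]
  refine ⟨fun t ht => ?_, fun t ht => ?_⟩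
  · have hright : s ≤ t → ContinuousWithinAt z (Ico s (s + δ)) t := fun hst => by
      have h1 : ContinuousWithinAt φ (Ico 0 δ) (t - s) :=
        hφ.continuousOn _ ⟨by linarith, by linarith [ht.2]⟩
      have h2 : ContinuousWithinAt (fun u => φ (u - s)) (Ico s (s + δ)) t :=
        ContinuousWithinAt.comp (f := fun u => u - s) h1 (by fun_prop)
          fun u hu => ⟨by linarith [hu.1], by linarith [hu.2]⟩
      exact h2.congr (fun u hu => hzr u hu.1) (hzr t hst)
    rcases lt_trichotomy t s with hlt | rfl | hgt
    · refine ((h.congr fun u hu => hzl u hu.2).continuousOn t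
        ⟨ht.1, hlt⟩).mono_of_mem_nhdsWithin ?_
      filter_upwards [self_mem_nhdsWithin, mem_nhdsWithin_of_mem_nhds (Iio_mem_nhds hlt)]
        with u h1 h2
      exact ⟨h1.1, h2⟩
    · have hleft : ContinuousWithinAt z (Iio t) t := hy.congr hzl hzs
      refine (hleft.union (hright le_rfl)).mono fun u hu => ?_
      exact (lt_or_ge u t).imp id fun h' => ⟨h', hu.2⟩
    · refine (hright hgt.le).mono_of_mem_nhdsWithin ?_
      filter_upwards [self_mem_nhdsWithin, mem_nhdsWithin_of_mem_nhds (Ioi_mem_nhds hgt)]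
        with u h1 h2
      exact ⟨(show s < u from h2).le, h1.2⟩
  · rcases lt_or_ge t s with hlt | hge
    · exact (h.congr fun u hu => hzl u hu.2).rightDeriv t ⟨ht.1, hlt⟩
    · obtain ⟨d, hd, hle⟩ := hφ.rightDeriv (t - s) ⟨by linarith, by linarith [ht.2]⟩
      refine ⟨d, ?_, by rwa [hzr t hge]⟩
      have h1 : HasDerivWithinAt (fun u => φ (u - s)) d (Ici t) t := by
        have := HasDerivWithinAt.scomp (h := fun u => u - s) (h' := 1) (s := Ici t) t hd
          (((hasDerivAt_id t).sub_const s).hasDerivWithinAt) fun u hu => by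
            simpa using hu
        rwa [one_smul] at this
      exact h1.congr (fun u hu => hzr u (hge.trans hu)) (hzr t hge)

/-- Approximate solutions with error at most `1` are Lipschitz, uniformly: by Grönwall they stay
in a fixed ball, on which `f` is bounded. -/
theorem exists_lipschitzOnWith_of_isApproxSol {N : ℕ} {f : E N → E N} {C₁ C₀ : ℝ}
    (hgrowth : ∀ z, ‖f z‖ ≤ C₁ * ‖z‖ + C₀) (x₀ : E N) (T : ℝ) :
    ∃ K : NNReal, ∀ η ≤ 1, ∀ s ≤ T, ∀ y : ℝ → E N, y 0 = x₀ → IsApproxSol f η s y →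
      LipschitzOnWith K y (Ico 0 s) := by
  set R := gronwallBound ‖x₀‖ |C₁| (|C₀| + 1) T with hR
  have hR0 : ∀ t ≤ T, gronwallBound ‖x₀‖ |C₁| (|C₀| + 1) t ≤ R := fun t ht =>
    gronwallBound_mono (norm_nonneg _) (by positivity) (abs_nonneg _) ht
  refine ⟨(|C₁| * R + (|C₀| + 1)).toNNReal, fun η hη s hs y hy0 hy => ?_⟩
  choose! d hd hle using hy.rightDeriv
  have hd1 : ∀ t ∈ Ico 0 s, ‖d t‖ ≤ |C₁| * ‖y t‖ + (|C₀| + 1) := fun t ht => by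
    have h1 := norm_le_norm_add_norm_sub' (d t) (f (y t))
    have h2 := hgrowth (y t)
    have h3 := mul_le_mul_of_nonneg_right (le_abs_self C₁) (norm_nonneg (y t))
    linarith [hle t ht, le_abs_self C₀]
  have hbd : ∀ t ∈ Ico 0 s, ‖y t‖ ≤ R := fun t ht => by
    have h1 := norm_le_gronwallBound_of_norm_deriv_right_le (f := y) (f' := d) (a := 0) (b := t)
      (hy.continuousOn.mono fun u hu => ⟨hu.1, hu.2.trans_lt ht.2⟩)
      (fun u hu => hd u ⟨hu.1, hu.2.trans ht.2⟩) (by rw [hy0])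
      (fun u hu => hd1 u ⟨hu.1, hu.2.trans ht.2⟩) t ⟨ht.1, le_rfl⟩
    rw [sub_zero] at h1
    exact h1.trans (hR0 t (ht.2.le.trans hs))
  have hd2 : ∀ t ∈ Ico 0 s, ‖d t‖ ≤ |C₁| * R + (|C₀| + 1) := fun t ht =>
    (hd1 t ht).trans (by gcongr; exact hbd t ht)
  have key : ∀ a ∈ Ico 0 s, ∀ b ∈ Ico 0 s, a ≤ b →
      dist (y a) (y b) ≤ (|C₁| * R + (|C₀| + 1)).toNNReal * dist a b := fun a ha b hb hab => by
    have h1 := norm_image_sub_le_of_norm_deriv_right_le_segment (f := y) (f' := d) (a := a) (b := b)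
      (hy.continuousOn.mono fun u hu => ⟨ha.1.trans hu.1, hu.2.trans_lt hb.2⟩)
      (fun u hu => hd u ⟨ha.1.trans hu.1, hu.2.trans hb.2⟩)
      (fun u hu => hd2 u ⟨ha.1.trans hu.1, hu.2.trans hb.2⟩) b ⟨hab, le_rfl⟩
    rw [dist_comm, dist_comm a b, dist_eq_norm, Real.dist_eq, abs_of_nonneg (sub_nonneg.2 hab)]
    exact h1.trans (mul_le_mul_of_nonneg_right (Real.le_coe_toNNReal _) (sub_nonneg.2 hab))
  refine LipschitzOnWith.of_dist_le_mul fun a ha b hb => ?_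
  rcases le_total a b with hab | hab
  · exact key a ha b hb hab
  · rw [dist_comm, dist_comm a b]
    exact key b hb a ha hab

/-- Approximate solutions of any accuracy exist up to time `T`, uniformly Lipschitz: Zorn's lemma
gives one whose interval of existence cannot be enlarged, and an approximate solution on `[0, s)`
with `s < T` can be continued past its limit at `s`. -/
theorem exists_lipschitzWith_isApproxSol {N : ℕ} {f : E N → E N} (hsc : SelfContinuous f)
    {C₁ C₀ : ℝ} (hgrowth : ∀ z, ‖f z‖ ≤ C₁ * ‖z‖ + C₀) (x₀ : E N) {T : ℝ} (hT : 0 < T) :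
    ∃ K : NNReal, ∀ η > 0, η ≤ 1 → ∃ y : ℝ → E N,
      y 0 = x₀ ∧ LipschitzWith K y ∧ IsApproxSol f η T y := by
  obtain ⟨K, hK⟩ := exists_lipschitzOnWith_of_isApproxSol hgrowth x₀ T
  refine ⟨lipschitzExtensionConstant (E N) * K, fun η hη hη1 => ?_⟩
  let S := {p : ℝ × (ℝ → E N) // p.1 ∈ Icc 0 T ∧ p.2 0 = x₀ ∧ IsApproxSol f η p.1 p.2}
  let r : S → S → Prop := fun p q => p.1.1 ≤ q.1.1 ∧ EqOn p.1.2 q.1.2 (Ico 0 p.1.1)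
  have hchain : ∀ c : Set S, IsChain r c → ∃ ub, ∀ a ∈ c, r a ub := by
    intro c hc
    classical
    have hbdd : BddAbove ((fun p : S => p.1.1) '' c) :=
      ⟨T, by rintro _ ⟨p, -, rfl⟩; exact p.2.1.2⟩
    let s : ℝ := sSup ((fun p : S => p.1.1) '' c)
    have hsle : ∀ p ∈ c, p.1.1 ≤ s := fun p hp => le_csSup hbdd (mem_image_of_mem _ hp)
    have hs0 : 0 ≤ s := Real.sSup_nonneg (by rintro _ ⟨p, -, rfl⟩; exact p.2.1.1)
    have hsT : s ≤ T := Real.sSup_le (by rintro _ ⟨p, -, rfl⟩; exact p.2.1.2) hT.le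
    let z : ℝ → E N := fun t => if h : ∃ p ∈ c, t < p.1.1 then h.choose.1.2 t else x₀
    have hz : ∀ p ∈ c, EqOn z p.1.2 (Ico 0 p.1.1) := fun p hp t ht => by
      have h : ∃ p ∈ c, t < p.1.1 := ⟨p, hp, ht.2⟩
      have hzt : z t = h.choose.1.2 t := dif_pos h
      obtain ⟨hq, hlt⟩ := h.choose_spec
      rw [hzt]
      by_cases heq : h.choose = p
      · rw [heq]
      · rcases hc hq hp heq with h1 | h1
        · exact h1.2 ⟨ht.1, hlt⟩
        · exact (h1.2 ht).symm
    refine ⟨⟨(s, z), ⟨hs0, hsT⟩, ?_, ?_⟩, fun p hp => ⟨hsle p hp, (hz p hp).symm⟩⟩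
    · by_cases h : ∃ p ∈ c, (0 : ℝ) < p.1.1
      · obtain ⟨p, hp, hlt⟩ := h
        exact (hz p hp ⟨le_rfl, hlt⟩).trans p.2.2.1
      · exact dif_neg h
    · refine isApproxSol_of_forall_lt fun t ht => ?_
      have hne : ((fun p : S => p.1.1) '' c).Nonempty := by
        by_contra hne
        have hs : s = 0 := by
          simp only [s, not_nonempty_iff_eq_empty.1 hne, Real.sSup_empty]
        exact absurd ht.2 (by simpa [hs] using ht.1)
      obtain ⟨_, ⟨p, hp, rfl⟩, hlt⟩ := exists_lt_of_lt_csSup hne ht.2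
      exact ⟨p.1.1, hlt, p.2.2.2.congr (hz p hp)⟩
  obtain ⟨⟨⟨s, y⟩, ⟨hs0, hsT⟩, hy0, hy⟩, hmax⟩ := exists_maximal_of_chains_bounded hchain
    fun {p q w} h1 h2 => ⟨h1.1.trans h2.1, fun t ht =>
      (h1.2 ht).trans (h2.2 ⟨ht.1, ht.2.trans_le h1.1⟩)⟩
  simp only at hs0 hsT hy0 hy
  -- `g` extends `y` continuously to the right end `s` of its interval.
  obtain ⟨g, hg, hgy, hg0⟩ : ∃ g : ℝ → E N,
      LipschitzWith (lipschitzExtensionConstant (E N) * K) g ∧ EqOn g y (Ico 0 s) ∧ g 0 = x₀ := by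
    rcases hs0.eq_or_lt with h0 | h0
    · exact ⟨fun _ => x₀, LipschitzWith.const' x₀, by simp [← h0], rfl⟩
    · obtain ⟨g, hg, hgy⟩ := (hK η hη1 s hsT y hy0 hy).extend_finite_dimension
      exact ⟨g, hg, hgy.symm, by rw [← hgy ⟨le_rfl, h0⟩, hy0]⟩
  have hga : IsApproxSol f η s g := hy.congr hgy
  rcases hsT.eq_or_lt with rfl | hlt
  · exact ⟨g, hg0, hg, hga⟩
  exfalso
  obtain ⟨δ, hδ, φ, hφ0, hφ⟩ := hsc.exists_isApproxSol (g s) hη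
  have hcat := hga.concat hs0 hg.continuous.continuousWithinAt hφ hφ0
  have hm := hmax ⟨(min (s + δ) T, fun t => if t < s then g t else φ (t - s)),
    ⟨le_min (by linarith) hT.le, min_le_right _ _⟩, ?_, hcat.mono (min_le_left _ _)⟩
    ⟨le_min (by linarith) hsT, fun t ht => by simp only [if_pos ht.2, hgy ht]⟩
  · exact absurd hm.1 (not_le.2 (lt_min (by linarith) hlt))
  · rcases hs0.eq_or_lt with h0 | h0
    · simp [← h0, hφ0, hg0]
    · simp [h0, hg0]

/-! ### Weak compactness of uniformly Lipschitz paths -/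

/-- Bounded sequences in a separable Hilbert space have weakly convergent subsequences. -/
theorem exists_subseq_tendsto_inner {H : Type*} [NormedAddCommGroup H] [InnerProductSpace ℝ H]
    [CompleteSpace H] [TopologicalSpace.SeparableSpace H] {u : ℕ → H} {R : ℝ} (hu : ∀ n, ‖u n‖ ≤ R) :
    ∃ (v : H) (k : ℕ → ℕ), StrictMono k ∧
      ∀ h : H, Tendsto (fun n => inner ℝ h (u (k n))) atTop (𝓝 (inner ℝ h v)) := by
  obtain ⟨w, -, k, hk, hlim⟩ := WeakDual.isSeqCompact_closedBall ℝ H 0 R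
    (x := fun n => StrongDual.toWeakDual (InnerProductSpace.toDual ℝ H (u n)))
    (fun n => by simpa using hu n)
  refine ⟨(InnerProductSpace.toDual ℝ H).symm (WeakDual.toStrongDual w), k, hk, fun h => ?_⟩
  have h1 := ((WeakDual.eval_continuous h).tendsto w).comp hlim
  rw [real_inner_comm, InnerProductSpace.toDual_symm_apply]
  refine h1.congr fun n => ?_
  rw [real_inner_comm]
  rfl

/-- On `L² ⊆ L¹` (finite measure), a bounded functional on `L¹` is an `L²` inner product: its
composition with the inclusion is bounded on `L²`. -/
theorem exists_inner_eq_of_dual_L1 {α F : Type*} [MeasurableSpace α] {μ : Measure α}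
    [IsFiniteMeasure μ] [NormedAddCommGroup F] [InnerProductSpace ℝ F] [CompleteSpace F]
    (l : StrongDual ℝ (Lp F 1 μ)) :
    ∃ h : Lp F 2 μ, ∀ (u : α → F) (hu1 : MemLp u 1 μ) (hu2 : MemLp u 2 μ),
      l (hu1.toLp u) = inner ℝ h (hu2.toLp u) := by
  have hmem : ∀ v : Lp F 2 μ, MemLp v 1 μ := fun v => (Lp.memLp v).mono_exponent one_le_two
  let inc : Lp F 2 μ →ₗ[ℝ] Lp F 1 μ :=
    { toFun := fun v => (hmem v).toLp v
      map_add' := fun v w => by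
        rw [← MemLp.toLp_add]
        exact MemLp.toLp_congr _ _ (Lp.coeFn_add v w)
      map_smul' := fun c v => by
        rw [RingHom.id_apply, ← MemLp.toLp_const_smul]
        exact MemLp.toLp_congr _ _ (Lp.coeFn_smul c v) }
  let C : ℝ≥0∞ := μ univ ^ (1 / (1 : ℝ≥0∞).toReal - 1 / (2 : ℝ≥0∞).toReal)
  have hC : C ≠ ∞ := ENNReal.rpow_ne_top_of_nonneg (by norm_num) (measure_ne_top μ _)
  have hinc : ∀ v, ‖inc v‖ ≤ C.toReal * ‖v‖ := fun v => by
    rw [show inc v = (hmem v).toLp v from rfl, Lp.norm_toLp, Lp.norm_def, mul_comm,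
      ← ENNReal.toReal_mul]
    exact ENNReal.toReal_mono (ENNReal.mul_ne_top (Lp.eLpNorm_ne_top v) hC)
      (eLpNorm_le_eLpNorm_mul_rpow_measure_univ one_le_two (Lp.aestronglyMeasurable v))
  let l2 : StrongDual ℝ (Lp F 2 μ) := l ∘L inc.mkContinuous C.toReal hinc
  refine ⟨(InnerProductSpace.toDual ℝ _).symm l2, fun u hu1 hu2 => ?_⟩
  rw [InnerProductSpace.toDual_symm_apply]
  change l _ = l ((hmem _).toLp _)
  exact congrArg l (MemLp.toLp_congr _ _ hu2.coeFn_toLp.symm)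

/-- Weak convergence in `W^{1,1}` follows from strong `L¹` convergence of the paths and weak `L²`
convergence of the derivatives: by Hahn–Banach, functionals on `W^{1,1}` extend to `L¹ × L¹`. -/
theorem tendsto_toWeakSpace_toW11 {N : ℕ} {T : ℝ} {y : ℕ → ℝ → E N} {x : ℝ → E N}
    (hy : ∀ j, AbsolutelyContinuousOnInterval (y j) 0 T)
    (hx : AbsolutelyContinuousOnInterval x 0 T)
    (hyx : Tendsto (fun j => (memLp_path (hy j)).toLp (y j)) atTop (𝓝 ((memLp_path hx).toLp x)))
    (hy2 : ∀ j, MemLp (deriv (y j)) 2 (volume.restrict (Ioo 0 T)))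
    (hx2 : MemLp (deriv x) 2 (volume.restrict (Ioo 0 T)))
    (hweak : ∀ h : Lp (E N) 2 (volume.restrict (Ioo 0 T)),
      Tendsto (fun j => inner ℝ h ((hy2 j).toLp (deriv (y j)))) atTop
        (𝓝 (inner ℝ h (hx2.toLp (deriv x))))) :
    Tendsto (fun j => toWeakSpace ℝ (W11 N T) (toW11 (y j) (hy j))) atTop
      (𝓝 (toWeakSpace ℝ (W11 N T) (toW11 x hx))) := by
  refine (WeakBilin.tendsto_iff_forall_eval_tendsto (topDualPairing ℝ (W11 N T)).flip ?_).2
    fun l => ?_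
  · intro a b hab
    by_contra hne
    obtain ⟨g, hg⟩ := SeparatingDual.exists_separating_of_ne (R := ℝ) hne
    exact hg (DFunLike.congr_fun hab g)
  change Tendsto (fun j => l (toW11 (y j) (hy j))) atTop (𝓝 (l (toW11 x hx)))
  obtain ⟨g, hg, -⟩ := exists_extension_norm_eq (W11 N T) l
  obtain ⟨h, hh⟩ := exists_inner_eq_of_dual_L1 (g ∘L ContinuousLinearMap.inr ℝ (L1 N T) (L1 N T))
  have key : ∀ (z : ℝ → E N) (hz : AbsolutelyContinuousOnInterval z 0 T)
      (hz2 : MemLp (deriv z) 2 (volume.restrict (Ioo 0 T))),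
      l (toW11 z hz) = (g ∘L ContinuousLinearMap.inl ℝ (L1 N T) (L1 N T)) ((memLp_path hz).toLp z)
        + inner ℝ h (hz2.toLp (deriv z)) := fun z hz hz2 => by
    rw [← hh _ (memLp_deriv_path hz), ← hg]
    simp only [ContinuousLinearMap.comp_apply, ← map_add]
    congr 1
    simp [toW11]
  simp only [key _ (hy _) (hy2 _), key x hx hx2]
  exact (((ContinuousLinearMap.continuous _).tendsto _).comp hyx).add (hweak h)

/-- The fundamental theorem of calculus for absolutely continuous paths. -/
theorem setIntegral_deriv_path {N : ℕ} {T : ℝ} {y : ℝ → E N}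
    (hy : AbsolutelyContinuousOnInterval y 0 T) {t : ℝ} (ht : t ∈ Icc 0 T) :
    ∫ u in Ioo 0 t, deriv y u = y t - y 0 := by
  have hyt : AbsolutelyContinuousOnInterval y 0 t :=
    hy.mono (uIcc_subset_uIcc_left (by rwa [uIcc_of_le (ht.1.trans ht.2)]))
  have hint : Integrable (deriv y) (volume.restrict (Ioo 0 t)) :=
    memLp_one_iff_integrable.1 (memLp_deriv_path hyt)
  ext i
  have h1 := (EuclideanSpace.proj i : E N →L[ℝ] ℝ).integral_comp_comm hint
  have h2 := (coord_absolutelyContinuous hyt i).integral_deriv_eq_sub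
  rw [intervalIntegral.integral_of_le ht.1, integral_Ioc_eq_integral_Ioo] at h2
  rw [PiLp.proj_apply] at h1
  rw [← h1, PiLp.sub_apply, ← h2]
  refine integral_congr_ae ?_
  filter_upwards [ae_differentiableAt_path hyt] with u hu
  exact (((EuclideanSpace.proj i : E N →L[ℝ] ℝ).hasFDerivAt.comp_hasDerivAt u
    hu.hasDerivAt)).deriv.symm

/-- Uniformly Lipschitz paths with a common starting point have a subsequence converging weakly in
`W^{1,1}`. The derivatives converge weakly in `L²` along a subsequence to some `v`; testing with
indicators of `(0, t)`, the paths converge pointwise to the primitive of `v`. -/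
theorem exists_subseq_tendsto_W11 {N : ℕ} {T : ℝ} (hT : 0 < T) (x₀ : E N) {K : NNReal}
    {y : ℕ → ℝ → E N} (hy : ∀ j, AbsolutelyContinuousOnInterval (y j) 0 T)
    (hlip : ∀ j, LipschitzWith K (y j)) (hy0 : ∀ j, y j 0 = x₀) :
    ∃ (x : ℝ → E N) (hx : AbsolutelyContinuousOnInterval x 0 T) (k : ℕ → ℕ), StrictMono k ∧
      x 0 = x₀ ∧
      Tendsto (fun j => toWeakSpace ℝ (W11 N T) (toW11 (y (k j)) (hy (k j)))) atTop
        (𝓝 (toWeakSpace ℝ (W11 N T) (toW11 x hx))) := by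
  set μ : Measure ℝ := volume.restrict (Ioo 0 T) with hμ
  have hderiv : ∀ j, ∀ᵐ t ∂μ, ‖deriv (y j) t‖ ≤ K := fun j =>
    Eventually.of_forall fun t => norm_deriv_le_of_lipschitz (hlip j)
  have hy2 : ∀ j, MemLp (deriv (y j)) 2 μ := fun j =>
    MemLp.of_bound (memLp_deriv_path (hy j)).aestronglyMeasurable K (hderiv j)
  have : Fact ((2 : ℝ≥0∞) ≠ ∞) := ⟨ENNReal.ofNat_ne_top⟩
  obtain ⟨v, k, hk, hweak⟩ := exists_subseq_tendsto_inner (H := Lp (E N) 2 μ)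
    (u := fun j => (hy2 j).toLp (deriv (y j)))
    (R := (μ univ).toNNReal ^ (2 : ℝ≥0∞).toReal⁻¹ * K) fun j =>
      Lp.norm_le_of_ae_bound K.2 (by
        filter_upwards [(hy2 j).coeFn_toLp, hderiv j] with t h1 h2
        rwa [h1])
  have hv1 : Integrable v μ := memLp_one_iff_integrable.1 ((Lp.memLp v).mono_exponent one_le_two)
  have hvint : IntervalIntegrable v volume 0 T := by
    rw [intervalIntegrable_iff_integrableOn_Ioo_of_le hT.le]
    exact hv1
  let x : ℝ → E N := fun t => x₀ + ∫ u in 0..t, v u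
  have hlim : ∀ t ∈ Icc 0 T, Tendsto (fun j => y (k j) t) atTop (𝓝 (x t)) := fun t ht => by
    have hres : μ.restrict (Ioo 0 t) = volume.restrict (Ioo 0 t) := by
      rw [hμ, Measure.restrict_restrict measurableSet_Ioo,
        inter_eq_left.2 (Ioo_subset_Ioo_right ht.2)]
    have hxt : x t = x₀ + ∫ u in Ioo 0 t, v u := by
      rw [← integral_Ioc_eq_integral_Ioo, ← intervalIntegral.integral_of_le ht.1]
    have hint : Tendsto (fun j => ∫ u in Ioo 0 t, deriv (y (k j)) u) atTop
        (𝓝 (∫ u in Ioo 0 t, v u)) := by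
      have hcoord : ∀ i, Tendsto (fun j => (∫ u in Ioo 0 t, deriv (y (k j)) u) i) atTop
          (𝓝 ((∫ u in Ioo 0 t, v u) i)) := fun i => by
        have h1 := hweak (indicatorConstLp 2 (measurableSet_Ioo (a := (0 : ℝ)) (b := t))
          (measure_ne_top μ _) (EuclideanSpace.single i 1))
        simp only [L2.inner_indicatorConstLp_eq_inner_setIntegral, hres,
          EuclideanSpace.inner_single_left, map_one, one_mul] at h1
        refine h1.congr fun j => ?_
        rw [← hres, integral_congr_ae (ae_restrict_of_ae (hy2 (k j)).coeFn_toLp)]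
      exact ((PiLp.continuous_toLp 2 _).tendsto _).comp (tendsto_pi_nhds.2 hcoord)
    rw [hxt]
    refine (hint.const_add x₀).congr fun j => ?_
    rw [setIntegral_deriv_path (hy (k j)) ht, hy0, add_sub_cancel]
  have hx : AbsolutelyContinuousOnInterval x 0 T := by
    have h1 : LipschitzOnWith K x (Icc 0 T) := LipschitzOnWith.of_dist_le_mul fun a ha b hb =>
      le_of_tendsto ((hlim a ha).dist (hlim b hb))
        (Eventually.of_forall fun j => (hlip (k j)).dist_le_mul a b)
    exact LipschitzOnWith.absolutelyContinuousOnInterval (by rwa [uIcc_of_le hT.le])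
  have hxv : deriv x =ᵐ[μ] v := by
    refine (ae_restrict_iff' measurableSet_Ioo).2 ?_
    filter_upwards [hvint.ae_hasDerivAt_integral] with t ht hmem
    rw [uIcc_of_le hT.le] at ht
    exact ((ht (Ioo_subset_Icc_self hmem) 0 ⟨le_rfl, hT.le⟩).const_add x₀).deriv
  have hx2 : MemLp (deriv x) 2 μ := (Lp.memLp v).ae_eq hxv.symm
  refine ⟨x, hx, k, hk, by simp [x], tendsto_toWeakSpace_toW11 _ hx ?_ (fun j => hy2 (k j)) hx2 ?_⟩
  · rw [Lp.tendsto_Lp_iff_tendsto_eLpNorm'']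
    simp only [eLpNorm_one_eq_lintegral_enorm]
    have h0 : (0 : ℝ≥0∞) = ∫⁻ _ in Ioo 0 T, 0 := by simp
    rw [h0]
    -- The paths and their limit stay within `K * T` of `x₀`.
    have hball : ∀ j, ∀ t ∈ Icc 0 T, dist (y (k j) t) x₀ ≤ K * T := fun j t ht => by
      rw [← hy0 (k j)]
      refine ((hlip (k j)).dist_le_mul t 0).trans (mul_le_mul_of_nonneg_left ?_ K.2)
      rw [Real.dist_eq, sub_zero, abs_of_nonneg ht.1]
      exact ht.2
    have hballx : ∀ t ∈ Icc 0 T, dist (x t) x₀ ≤ K * T := fun t ht =>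
      le_of_tendsto ((hlim t ht).dist tendsto_const_nhds)
        (Eventually.of_forall fun j => hball j t ht)
    refine tendsto_lintegral_of_dominated_convergence'
      (fun _ => ENNReal.ofReal (K * T + K * T)) ?_ ?_ ?_ ?_
    · exact fun j => ((memLp_path (hy (k j))).sub (memLp_path hx)).aestronglyMeasurable.enorm
    · intro j
      filter_upwards [ae_restrict_mem measurableSet_Ioo] with t ht
      have ht' := Ioo_subset_Icc_self ht
      rw [← ofReal_norm, Pi.sub_apply, ← dist_eq_norm]
      exact ENNReal.ofReal_le_ofReal ((dist_triangle_right _ _ x₀).trans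
        (add_le_add (hball j t ht') (hballx t ht')))
    · simp [ENNReal.mul_ne_top]
    · filter_upwards [ae_restrict_mem measurableSet_Ioo] with t ht
      have h1 := ((hlim t (Ioo_subset_Icc_self ht)).sub_const (x t)).enorm
      simpa using h1
  · have h1 : hx2.toLp (deriv x) = v := by
      rw [MemLp.toLp_congr hx2 (Lp.memLp v) hxv, Lp.toLp_coeFn]
    rw [h1]
    exact hweak

/-! ### The error of an approximate solution -/

theorem IsApproxSol.pathError_le {N : ℕ} {f : E N → E N} {η T : ℝ} {y : ℝ → E N}
    (h : IsApproxSol f η T y) (hy : AbsolutelyContinuousOnInterval y 0 T) :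
    pathError f T y ≤ ENNReal.ofReal η * ENNReal.ofReal T := by
  have h1 : ∀ᵐ t ∂(volume.restrict (Ioo 0 T)), ‖deriv y t - f (y t)‖ₑ ≤ ENNReal.ofReal η := by
    filter_upwards [ae_differentiableAt_path hy, ae_restrict_mem measurableSet_Ioo] with t ht hmem
    obtain ⟨d, hd, hle⟩ := h.rightDeriv t (Ioo_subset_Ico_self hmem)
    rw [(uniqueDiffWithinAt_Ici t).eq_deriv _ ht.hasDerivAt.hasDerivWithinAt hd,
      ← ofReal_norm]
    exact ENNReal.ofReal_le_ofReal hle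
  calc pathError f T y ≤ ∫⁻ _ in Ioo 0 T, ENNReal.ofReal η := lintegral_mono_ae h1
    _ = ENNReal.ofReal η * ENNReal.ofReal T := by simp

end SelfCont

theorem theorem1p3 (N : ℕ) (f : SelfCont.E N → SelfCont.E N) (hf : Measurable f)
    (hsc : SelfCont.SelfContinuous f) (C₁ C₀ : ℝ) (hgrowth : ∀ z, ‖f z‖ ≤ C₁ * ‖z‖ + C₀)
    (x₀ : SelfCont.E N) (T : ℝ) (hT : 0 < T) :
    ∃ x : ℝ → SelfCont.E N, SelfCont.IsGeneralizedSolution f T x₀ x := by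
  obtain ⟨K, hK⟩ := SelfCont.exists_lipschitzWith_isApproxSol hsc hgrowth x₀ hT
  have hη : ∀ j : ℕ, (0 : ℝ) < 1 / ((j : ℝ) + 1) ∧ 1 / ((j : ℝ) + 1) ≤ 1 := fun j =>
    ⟨by positivity, by rw [div_le_one (by positivity)]; linarith [(Nat.cast_nonneg j : (0 : ℝ) ≤ j)]⟩
  choose y hy0 hlip happ using fun j : ℕ => hK _ (hη j).1 (hη j).2
  have hy : ∀ j, AbsolutelyContinuousOnInterval (y j) 0 T := fun j =>
    (hlip j).lipschitzOnWith.absolutelyContinuousOnInterval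
  obtain ⟨x, hx, k, hk, hx0, hlim⟩ := SelfCont.exists_subseq_tendsto_W11 hT x₀ hy hlip hy0
  refine ⟨x, hx, hx0, fun j => y (k j), fun j => hy (k j), fun j => hy0 _, hlim, ?_⟩
  have h1 : Tendsto (fun j : ℕ => ENNReal.ofReal (1 / ((j : ℝ) + 1)) * ENNReal.ofReal T) atTop
      (𝓝 0) := by
    have h2 := ENNReal.tendsto_ofReal (tendsto_one_div_add_atTop_nhds_zero_nat (𝕜 := ℝ))
    have h3 := ENNReal.Tendsto.mul_const h2 (Or.inr (ENNReal.ofReal_ne_top (r := T)))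
    simpa using h3
  exact tendsto_of_tendsto_of_tendsto_of_le_of_le tendsto_const_nhds (h1.comp hk.tendsto_atTop)
    (fun _ => zero_le) fun j => (happ (k j)).pathError_le (hy (k j))
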